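/- **Conventions.** Let $\mathbb N=\{1,2,\dots\}$ and let $[\mathbb N]^{<\omega}$ be the set of finite subsets of $\mathbb N$. For $a,b\in[\mathbb N]^{<\omega}$ write $a<b$ if every element of $a$ is smaller than every element of $b$. A *finite disjoint collection* is a finite (possibly empty) set $\mathbf s=\{s_1<\dots<s_k\}$ of non-empty finite subsets of $\mathbb N$; an *infinite disjoint collection* is an infinite set $\mathcal D=\{s_1<s_2<\cdots\}$ of non-empty finite subsets of $\mathbb N$. The sets of these are $\mathcal B^{<\omega}(\mathbb N)$ and $\mathcal B^{\omega}(\mathbb N)$. $FU(\mathcal D)$ is the set of unions of finitely many (at least one) members of $\mathcal D$. Write $\mathcal D_1<\mathcal D_2$ if $\mathcal D_1\subseteq FU(\mathcal D_2)$, let $\mathcal B^{<\omega}(\mathcal D)$ be the set of finite disjoint collections with all members in $FU(\mathcal D)$, and write $\mathbf s\propto\mathcal D$ if $\mathbf s$ is an initial segment of $\mathcal D$. For a finite set $\mathbf s$ of finite subsets of $\mathbb N$ and $\mathcal D\in\mathcal B^\omega(\mathbb N)$ put $$[\mathbf s,\mathcal D]=\{\mathcal D_1\in\mathcal B^\omega(\mathbb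 N):\ \mathbf s\propto\mathcal D_1\ \text{and}\ \{d\in\mathcal D_1: \textstyle\bigcup\mathbf s<d\}\subseteq FU(\mathcal D)\}$$ (empty if $\mathbf s$ is not a finite disjoint collection). $\mathfrak T_E$ is the topology on $\mathcal B^\omega(\mathbb N)$ generated by the sets $[\mathbf s,\mathcal D]$ with $\mathbf s\in\mathcal B^{<\omega}(\mathbb N)$, $\mathcal D\in\mathcal B^\omega(\mathbb N)$, and $\hat{\mathcal U}$ is the $\mathfrak T_E$-closure of $\mathcal U\subseteq\mathcal B^\omega(\mathbb N)$. **Schreier families.** For every non-zero countable limit ordinal $\lambda$ fix a strictly increasing sequence $(\lambda_n)_{n\ge1}$ of successor ordinals smaller than $\lambda$ with $\sup_n\lambda_n=\lambda$. Define families $\mathcal A_\xi\subseteq[\mathbb N]^{<\omega}$, $\xi<\omega_1$, recursively: 1. $\mathcal A_0=\{\emptyset\}$; 2. $\mathcal A_{\zeta+1}=\{\{n\}\cup s: n\in\mathbb N,\ \{n\}<s,\ s\in\mathcal A_\zeta\}$; 3. $\mathcal A_{\omega^{\beta+1}}=\{s_1\cup\dots\cup s_n: s_1<\dots<s_n,\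 s_i\in\mathcal A_{\omega^\beta},\ n=\min s_1\}$; 4. $\mathcal A_{\omega^\lambda}=\{s\ne\emptyset: s\in\mathcal A_{\omega^{\lambda_n}}\text{ for } n=\min s\}$ for a non-zero countable limit ordinal $\lambda$; 5. if $\xi=\omega^{a_0}p_0+\dots+\omega^{a_m}p_m$ with $a_0>\dots>a_m>0$, integers $p_i\ge1$, and $p_0>1$ or $m\ge1$, then $\mathcal A_\xi$ consists of the sets $s_0\cup\dots\cup s_m$ with $s_m<\dots<s_0$, where each $s_i=s^i_1\cup\dots\cup s^i_{p_i}$ with $s^i_1<\dots<s^i_{p_i}$ in $\mathcal A_{\omega^{a_i}}$. Let $\mathcal B^0=\{\emptyset\}$ and, for $1\le\xi<\omega_1$, let $\mathcal B^\xi$ be the set of non-empty finite disjoint collections $\{s_1<\dots<s_k\}$ with $\{\min s_1,\dots,\min s_k\}\in\mathcal A_\xi$. **Theorem 4.2.** For every choice of the sequences $(\lambda_n)$ the following holds. Let $\mathcal U\subseteq\mathcal B^\omega(\mathbb N)$, $\mathbf s\in\mathcal B^{<\omega}(\mathbb N)$ and $\mathcal D\in\mathcal B^\omega(\mathbb N)$.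 Then * either there exists $\mathcal D_1<\mathcal D$ in $\mathcal B^\omega(\mathbb N)$ such that $[\mathbf s,\mathcal D_1]\subseteq\hat{\mathcal U}$; * or there exists a countable ordinal $\xi_0$ such that for every countable ordinal $\xi>\xi_0$ there exists $\mathcal D_1<\mathcal D$ in $\mathcal B^\omega(\mathbb N)$ with $[\mathbf s\cup\mathbf t,\mathcal D_1]\subseteq\mathcal B^\omega(\mathbb N)\setminus\mathcal U$ for every $\mathbf t\in\mathcal B^\xi\cap\mathcal B^{<\omega}(\mathcal D_1)$. -/

import Mathlib

open scoped Ordinal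

namespace BlockSchreier

/-! Throughout, the natural numbers are `{1, 2, …}`, that is, `ℕ+`. -/

/-- `s < t` for finite sets of natural numbers: every element of `s` lies below every element of
`t` (for non-empty `s`, `t` this is `max s < min t`; it holds when one of them is empty). -/
def BlockLT (s t : Finset ℕ+) : Prop := ∀ x ∈ s, ∀ y ∈ t, x < y

/-- A choice, for every non-zero countable limit ordinal `l`, of a strictly increasing sequence
`(l_n)`, `n = 1, 2, …`, of successor ordinals smaller than `l` with supremum `l`. -/
def IsFundamentalChoice (lam : Ordinal.{0} → ℕ+ → Ordinal.{0}) : Prop :=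
  ∀ l : Ordinal.{0}, l < ω₁ → Order.IsSuccLimit l →
    StrictMono (lam l) ∧ (∀ n, ∃ β, lam l n = β + 1) ∧ (∀ n, lam l n < l) ∧
      IsLUB (Set.range (lam l)) l

/-- The recursive thin Schreier system: `Schreier lam ξ s` says that `s` belongs to the family
`𝒜_ξ` built from the sequences `lam`. The five clauses concern disjoint classes of ordinals
(zero; successors; `ω ^ (β + 1)`; `ω ^ l` with `l` a limit; the other limits, in Cantor normal
form), and each of them refers to smaller ordinals only. -/
inductive Schreier (lam : Ordinal.{0} → ℕ+ → Ordinal.{0}) : Ordinal.{0} → Finset ℕ+ → Prop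
  /-- `𝒜_0 = {∅}`. -/
  | zero : Schreier lam 0 ∅
  /-- `𝒜_{ζ+1}`: the sets `{n} ∪ s` with `{n} < s` and `s ∈ 𝒜_ζ`. -/
  | succ (ζ : Ordinal.{0}) (n : ℕ+) (s : Finset ℕ+) (hlt : BlockLT {n} s)
      (hs : Schreier lam ζ s) : Schreier lam (ζ + 1) (insert n s)
  /-- `𝒜_{ω^(β+1)}`: the unions of `s_1 < ⋯ < s_n` in `𝒜_{ω^β}` with `n = min s_1`. -/
  | opow_succ (β : Ordinal.{0}) (n : ℕ+) (s : Fin (n : ℕ) → Finset ℕ+)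
      (hmin : IsLeast (s ⟨0, n.pos⟩ : Set ℕ+) n)
      (hlt : ∀ i j, i < j → BlockLT (s i) (s j))
      (hs : ∀ i, Schreier lam (ω ^ β) (s i)) :
      Schreier lam (ω ^ (β + 1)) (Finset.univ.biUnion s)
  /-- `𝒜_{ω^l}`, `l` a limit: the sets `s` with `s ∈ 𝒜_{ω^(l_n)}` for `n = min s`. -/
  | opow_limit (l : Ordinal.{0}) (hl : Order.IsSuccLimit l) (n : ℕ+) (s : Finset ℕ+)
      (hmin : IsLeast (s : Set ℕ+) n) (hs : Schreier lam (ω ^ lam l n) s) :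
      Schreier lam (ω ^ l) s
  /-- `𝒜_ξ` for `ξ = ω^(a_0) p_0 + ⋯ + ω^(a_m) p_m`, with `a_0 > ⋯ > a_m > 0`, all `p_i ≥ 1`,
  and either `p_0 > 1` or `m ≥ 1`: the unions `s_0 ∪ ⋯ ∪ s_m` with `s_m < ⋯ < s_0`, where each
  `s_i` is the union of `p_i` successive members of `𝒜_{ω^(a_i)}`. -/
  | sum (m : ℕ) (a : Fin (m + 1) → Ordinal.{0}) (p : Fin (m + 1) → ℕ)
      (ha : StrictAnti a) (ha0 : ∀ i, 0 < a i) (hp : ∀ i, 1 ≤ p i) (hne : 1 < p 0 ∨ 1 ≤ m)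
      (s : (i : Fin (m + 1)) → Fin (p i) → Finset ℕ+)
      (hlt : ∀ i, ∀ k k', k < k' → BlockLT (s i k) (s i k'))
      (hlt' : ∀ i j, i < j → ∀ k k', BlockLT (s j k) (s i k'))
      (hs : ∀ i k, Schreier lam (ω ^ a i) (s i k)) :
      Schreier lam (List.ofFn fun i => ω ^ a i * (p i : Ordinal.{0})).sum
        (Finset.univ.biUnion fun i => Finset.univ.biUnion fun k => s i k)

/-- A (block) disjoint collection: its members are non-empty, and any two distinct members are
successive. A finite or infinite such collection is the same thing as an increasing sequence
`s_1 < s_2 < ⋯` of non-empty finite sets. -/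
def IsDisjointCollection (C : Set (Finset ℕ+)) : Prop :=
  (∀ s ∈ C, s.Nonempty) ∧ C.Pairwise fun s t => BlockLT s t ∨ BlockLT t s

/-- The set of all finite disjoint collections (including the empty one). -/
def FinColl : Set (Finset (Finset ℕ+)) := {s | IsDisjointCollection (s : Set (Finset ℕ+))}

/-- The space of all infinite disjoint collections. -/
structure InfColl where
  /-- the members of the collection -/
  carrier : Set (Finset ℕ+)
  infinite : carrier.Infinite
  isDisjointCollection : IsDisjointCollection carrier

/-- `FU(C)`: the finite unions of (one or more) members of `C`. -/
def FU (C : Set (Finset ℕ+)) : Set (Finset ℕ+) :=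
  {u | ∃ f : Finset (Finset ℕ+), f.Nonempty ∧ (f : Set (Finset ℕ+)) ⊆ C ∧ u = f.biUnion id}

/-- `D₁ < D₂` for infinite disjoint collections: `D₁ ⊆ FU(D₂)`. -/
def Refines (D₁ D₂ : InfColl) : Prop := D₁.carrier ⊆ FU D₂.carrier

/-- The finite disjoint collections with members in `FU(D)`. -/
def finCollIn (D : InfColl) : Set (Finset (Finset ℕ+)) :=
  {t | t ∈ FinColl ∧ (t : Set (Finset ℕ+)) ⊆ FU D.carrier}

/-- `s` is an initial segment of the infinite disjoint collection `D`. -/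
def IsInitialSegment (s : Finset (Finset ℕ+)) (D : InfColl) : Prop :=
  (s : Set (Finset ℕ+)) ⊆ D.carrier ∧ ∀ a ∈ s, ∀ b ∈ D.carrier, b ∉ s → BlockLT a b

/-- The basic set `[s, D]`: all `D₁` having `s` as an initial segment and such that the members
of `D₁` that lie after `⋃ s` belong to `FU(D)`. -/
def basicSet (s : Finset (Finset ℕ+)) (D : InfColl) : Set InfColl :=
  {D₁ | IsInitialSegment s D₁ ∧ {d ∈ D₁.carrier | BlockLT (s.biUnion id) d} ⊆ FU D.carrier}

/-- The Ellentuck-type topology on the infinite disjoint collections, generated by the sets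
`[s, D]` with `s` a finite and `D` an infinite disjoint collection. -/
abbrev ellentuckTopology : TopologicalSpace InfColl :=
  TopologicalSpace.generateFrom {V | ∃ s ∈ FinColl, ∃ D : InfColl, V = basicSet s D}

/-- The closure of a family in the Ellentuck-type topology. -/
def ellentuckClosure (U : Set InfColl) : Set InfColl := @closure InfColl ellentuckTopology U

/-- The minimum of a non-empty finite set (the value at `∅` plays no role). -/
def blockMin (a : Finset ℕ+) : ℕ+ := if h : a.Nonempty then a.min' h else 1

/-- The block Schreier family: `ℬ^0 = {∅}`, and for `ξ ≥ 1` the family `ℬ^ξ` consists of the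
non-empty finite disjoint collections `(s_1, …, s_k)` with `{min s_1, …, min s_k} ∈ 𝒜_ξ`. -/
def blockFamily (lam : Ordinal.{0} → ℕ+ → Ordinal.{0}) (ξ : Ordinal.{0}) :
    Set (Finset (Finset ℕ+)) :=
  {s | (ξ = 0 ∧ s = ∅) ∨
    (1 ≤ ξ ∧ s ∈ FinColl ∧ s.Nonempty ∧ Schreier lam ξ (s.image blockMin))}

end BlockSchreier

/-!
This is Milliken's theorem in topological form: Ellentuck-open families are Ramsey, and the theorem
is the case of the complement of the closure of `U`.

An open family `O` is treated by combinatorial forcing. Say that `E` accepts `s` if `[s, E] ⊆ O`,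
and rejects `s` if no refinement of `E` accepts it. A fusion yields a refinement `E` of `D` that
accepts or rejects every `s ∪ t` with `t` a finite collection in `FU(E)`. If `E` rejects `s ∪ t`,
then Hindman's theorem, applied to the colouring of `x ∈ FU(E)` according to whether `E` rejects
`s ∪ t ∪ {x}`, must return rejected `x` only, since otherwise some refinement would accept `s ∪ t`.
A second fusion propagates the rejection of `s` to all `s ∪ t`. An open family that met `[s, E]`
would contain some `[s ∪ t, G]` with `G` refining `E` above `s ∪ t`, contrary to this rejection.
-/

namespace BlockSchreier

variable {a b c u : Finset ℕ+} {C C' : Set (Finset ℕ+)} {s t : Finset (Finset ℕ+)}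
  {D E E' E'' G : InfColl} {O : Set InfColl}

/-! ### Blocks and their finite unions -/

theorem BlockLT.mono {a' b' : Finset ℕ+} (h : BlockLT a b) (ha : a' ⊆ a) (hb : b' ⊆ b) :
    BlockLT a' b' :=
  fun x hx y hy => h x (ha hx) y (hb hy)

theorem BlockLT.trans (hab : BlockLT a b) (hb : b.Nonempty) (hbc : BlockLT b c) : BlockLT a c := by
  obtain ⟨y, hy⟩ := hb
  exact fun x hx z hz => (hab x hx y hy).trans (hbc y hy z hz)

theorem not_blockLT_self (ha : a.Nonempty) : ¬ BlockLT a a := by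
  obtain ⟨x, hx⟩ := ha
  exact fun h => lt_irrefl x (h x hx x hx)

theorem blockLT_union_left : BlockLT (a ∪ b) c ↔ BlockLT a c ∧ BlockLT b c := by
  simp only [BlockLT, Finset.mem_union, or_imp, forall_and]

theorem blockLT_union_right : BlockLT a (b ∪ c) ↔ BlockLT a b ∧ BlockLT a c := by
  simp only [BlockLT, Finset.mem_union, or_imp, forall_and]

theorem blockLT_biUnion_left : BlockLT (s.biUnion id) b ↔ ∀ a ∈ s, BlockLT a b := by
  simp only [BlockLT, Finset.mem_biUnion, id_eq]
  grind

theorem blockLT_biUnion_right : BlockLT a (s.biUnion id) ↔ ∀ b ∈ s, BlockLT a b := by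
  simp only [BlockLT, Finset.mem_biUnion, id_eq]
  grind

theorem blockMin_lt_blockMin (ha : a.Nonempty) (hb : b.Nonempty) (h : BlockLT a b) :
    blockMin a < blockMin b := by
  simpa only [blockMin, dif_pos ha, dif_pos hb] using h _ (a.min'_mem ha) _ (b.min'_mem hb)

theorem IsDisjointCollection.mono (hC : IsDisjointCollection C) (h : C' ⊆ C) :
    IsDisjointCollection C' :=
  ⟨fun a ha => hC.1 a (h ha), hC.2.mono h⟩

theorem IsDisjointCollection.blockLT_of_blockMin_le (hC : IsDisjointCollection C) (ha : a ∈ C)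
    (hb : b ∈ C) (hab : a ≠ b) (h : blockMin a ≤ blockMin b) : BlockLT a b :=
  (hC.2 ha hb hab).resolve_right fun hba =>
    h.not_gt (blockMin_lt_blockMin (hC.1 b hb) (hC.1 a ha) hba)

theorem subset_FU (C : Set (Finset ℕ+)) : C ⊆ FU C := fun d hd =>
  ⟨{d}, Finset.singleton_nonempty d, by simpa using hd, by simp⟩

theorem union_mem_FU (ha : a ∈ FU C) (hb : b ∈ FU C) : a ∪ b ∈ FU C := by
  obtain ⟨f, hf, hfC, rfl⟩ := ha
  obtain ⟨g, -, hgC, rfl⟩ := hb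
  refine ⟨f ∪ g, hf.mono Finset.subset_union_left, ?_, Finset.union_biUnion.symm⟩
  rw [Finset.coe_union]
  exact Set.union_subset hfC hgC

theorem biUnion_mem_FU (hs : s.Nonempty) (h : (s : Set (Finset ℕ+)) ⊆ FU C) :
    s.biUnion id ∈ FU C := by
  rw [← Finset.sup_eq_biUnion, ← Finset.sup'_eq_sup hs]
  exact Finset.sup'_induction hs id (fun _ ha _ hb => union_mem_FU ha hb) h

theorem FU_subset_FU_of_subset_FU (h : C ⊆ FU C') : FU C ⊆ FU C' := by
  rintro u ⟨f, hf, hfC, rfl⟩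
  exact biUnion_mem_FU hf (hfC.trans h)

theorem FU_mono (h : C ⊆ C') : FU C ⊆ FU C' :=
  FU_subset_FU_of_subset_FU (h.trans (subset_FU C'))

theorem nonempty_of_mem_FU (hC : ∀ a ∈ C, a.Nonempty) (hu : u ∈ FU C) : u.Nonempty := by
  obtain ⟨f, ⟨a, ha⟩, hfC, rfl⟩ := hu
  exact (hC a (hfC ha)).mono (Finset.subset_biUnion_of_mem id ha)

theorem IsDisjointCollection.exists_last_block (hC : IsDisjointCollection C) (hu : u ∈ FU C) :
    ∃ b ∈ C, b ⊆ u ∧ u ⊆ b.biUnion Finset.Iic := by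
  obtain ⟨f, hf, hfC, rfl⟩ := hu
  obtain ⟨b, hb, hmax⟩ := f.exists_max_image blockMin hf
  refine ⟨b, hfC hb, Finset.subset_biUnion_of_mem id hb,
    Finset.biUnion_subset.2 fun a ha x hx => ?_⟩
  obtain rfl | hab := eq_or_ne a b
  · exact Finset.mem_biUnion.2 ⟨x, hx, Finset.mem_Iic.2 le_rfl⟩
  · obtain ⟨y, hy⟩ := hC.1 b (hfC hb)
    have hlt : BlockLT a b := hC.blockLT_of_blockMin_le (hfC ha) (hfC hb) hab (hmax a ha)
    exact Finset.mem_biUnion.2 ⟨y, hy, Finset.mem_Iic.2 (hlt x hx y hy).le⟩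

/-! ### Refinements and tails of infinite collections -/

theorem InfColl.nonempty (D : InfColl) : D.carrier.Nonempty := D.infinite.nonempty

theorem InfColl.nonempty_of_mem_FU (D : InfColl) (hu : u ∈ FU D.carrier) : u.Nonempty :=
  BlockSchreier.nonempty_of_mem_FU D.isDisjointCollection.1 hu

theorem Refines.refl (D : InfColl) : Refines D D := subset_FU _

theorem Refines.FU_subset (h : Refines E D) : FU E.carrier ⊆ FU D.carrier :=
  FU_subset_FU_of_subset_FU h

theorem Refines.trans (h : Refines E' E) (h' : Refines E D) : Refines E' D :=
  Set.Subset.trans h h'.FU_subset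

theorem InfColl.finite_not_blockLT (D : InfColl) (a : Finset ℕ+) :
    {d ∈ D.carrier | ¬ BlockLT a d}.Finite := by
  have hinj : Set.InjOn blockMin {d ∈ D.carrier | ¬ BlockLT a d} := fun d hd e he hde => by
    by_contra hne
    have hlt := D.isDisjointCollection.blockLT_of_blockMin_le hd.1 he.1 hne hde.le
    exact (blockMin_lt_blockMin (D.isDisjointCollection.1 d hd.1)
      (D.isDisjointCollection.1 e he.1) hlt).ne hde
  refine Set.Finite.of_finite_image ((a.biUnion Finset.Iic).finite_toSet.subset ?_) hinj
  rintro _ ⟨d, ⟨-, had⟩, rfl⟩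
  simp only [BlockLT, not_forall, not_lt] at had
  obtain ⟨x, hx, y, hy, hyx⟩ := had
  have hmin : blockMin d ≤ y := by
    rw [blockMin, dif_pos ⟨y, hy⟩]
    exact d.min'_le y hy
  exact Finset.mem_biUnion.2 ⟨x, hx, Finset.mem_Iic.2 (hmin.trans hyx)⟩

/-- The infinite collection of the members of `D` that lie after `a`. -/
def InfColl.tail (D : InfColl) (a : Finset ℕ+) : InfColl where
  carrier := {d ∈ D.carrier | BlockLT a d}
  infinite := (D.infinite.sdiff (D.finite_not_blockLT a)).mono fun _ hd =>
    ⟨hd.1, not_not.1 fun had => hd.2 ⟨hd.1, had⟩⟩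
  isDisjointCollection := D.isDisjointCollection.mono (Set.sep_subset _ _)

theorem FU_tail (D : InfColl) (a : Finset ℕ+) :
    FU (D.tail a).carrier = {u ∈ FU D.carrier | BlockLT a u} := by
  ext u
  constructor
  · rintro ⟨f, hf, hfD, rfl⟩
    exact ⟨⟨f, hf, fun b hb => (hfD hb).1, rfl⟩, blockLT_biUnion_right.2 fun b hb => (hfD hb).2⟩
  · rintro ⟨⟨f, hf, hfD, rfl⟩, hlt⟩
    exact ⟨f, hf, fun b hb => ⟨hfD hb, blockLT_biUnion_right.1 hlt b hb⟩, rfl⟩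

theorem InfColl.tail_refines (D : InfColl) (a : Finset ℕ+) : Refines (D.tail a) D :=
  fun _ hd => subset_FU _ hd.1

theorem InfColl.tail_refines_tail (D : InfColl) (h : a ⊆ b) : Refines (D.tail b) (D.tail a) :=
  fun _ hd => subset_FU _ ⟨hd.1, hd.2.mono h subset_rfl⟩

theorem InfColl.tail_biUnion_refines (D : InfColl) (h : s ⊆ t) :
    Refines (D.tail (t.biUnion id)) (D.tail (s.biUnion id)) :=
  D.tail_refines_tail (Finset.biUnion_subset_biUnion_of_subset_left id h)

theorem Refines.tail (h : Refines (E.tail a) D) : Refines (E.tail a) (D.tail a) :=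
  fun _ hd => (FU_tail D a).ge ⟨h hd, hd.2⟩

theorem Refines.blockLT_of_mem_FU (h : Refines E (D.tail a)) (hu : u ∈ FU E.carrier) :
    BlockLT a u :=
  ((FU_tail D a).le (h.FU_subset hu)).2

theorem InfColl.exists_first_block (D : InfColl) :
    ∃ a ∈ D.carrier, ∀ b ∈ D.carrier, b ≠ a → BlockLT a b := by
  obtain ⟨a, ha, hmin⟩ := WellFounded.has_min (InvImage.wf blockMin wellFounded_lt) _ D.nonempty
  exact ⟨a, ha, fun b hb hba =>
    D.isDisjointCollection.blockLT_of_blockMin_le ha hb hba.symm (not_lt.1 (hmin b hb))⟩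

/-! ### Block sequences and fusion -/

/-- A block sequence: a sequence `d 0 < d 1 < ⋯` of non-empty finite sets. -/
structure IsBlockSeq (d : ℕ → Finset ℕ+) : Prop where
  nonempty (n : ℕ) : (d n).Nonempty
  blockLT {i j : ℕ} (h : i < j) : BlockLT (d i) (d j)

namespace IsBlockSeq

variable {d : ℕ → Finset ℕ+}

theorem tail (hd : IsBlockSeq d) : IsBlockSeq fun n => d (n + 1) :=
  ⟨fun n => hd.nonempty (n + 1), fun h => hd.blockLT (Nat.succ_lt_succ h)⟩

theorem lt_of_blockLT (hd : IsBlockSeq d) {i j : ℕ} (h : BlockLT (d i) (d j)) : i < j := by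
  by_contra hij
  obtain rfl | hji := (not_lt.1 hij).eq_or_lt
  · exact not_blockLT_self (hd.nonempty j) h
  · exact not_blockLT_self (hd.nonempty i) (h.trans (hd.nonempty j) (hd.blockLT hji))

theorem injective (hd : IsBlockSeq d) : Function.Injective d :=
  Function.Injective.of_lt_imp_ne fun _ j hij h =>
    not_blockLT_self (hd.nonempty j) (by simpa only [h] using hd.blockLT hij)

theorem isDisjointCollection_range (hd : IsBlockSeq d) : IsDisjointCollection (Set.range d) := by
  refine ⟨Set.forall_mem_range.2 hd.nonempty, ?_⟩
  rintro _ ⟨i, rfl⟩ _ ⟨j, rfl⟩ hij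
  exact (ne_of_apply_ne d hij).lt_or_gt.imp hd.blockLT hd.blockLT

/-- The infinite collection enumerated by a block sequence. -/
def toInfColl (hd : IsBlockSeq d) : InfColl where
  carrier := Set.range d
  infinite := Set.infinite_range_of_injective hd.injective
  isDisjointCollection := hd.isDisjointCollection_range

end IsBlockSeq

/-- A fusion sequence: a block is chosen in each collection, and the next collection refines the
part of the current one that lies after this block. -/
structure FusionSeq where
  block : ℕ → Finset ℕ+
  coll : ℕ → InfColl
  block_mem (n : ℕ) : block n ∈ (coll n).carrier
  refines_tail (n : ℕ) : Refines (coll (n + 1)) ((coll n).tail (block n))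

namespace FusionSeq

variable (F : FusionSeq)

theorem coll_refines {i j : ℕ} (h : i ≤ j) : Refines (F.coll j) (F.coll i) := by
  induction j, h using Nat.le_induction with
  | base => exact Refines.refl _
  | succ j _ ih => exact ((F.refines_tail j).trans (InfColl.tail_refines _ _)).trans ih

theorem block_mem_FU {i j : ℕ} (h : i ≤ j) : F.block j ∈ FU (F.coll i).carrier :=
  F.coll_refines h (F.block_mem j)

theorem isBlockSeq : IsBlockSeq F.block where
  nonempty n := (F.coll n).isDisjointCollection.1 _ (F.block_mem n)
  blockLT {i _} h := (F.refines_tail i).blockLT_of_mem_FU (F.block_mem_FU h)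

/-- The limit of a fusion sequence: the collection of the chosen blocks. -/
def limit : InfColl := F.isBlockSeq.toInfColl

theorem limit_refines : Refines F.limit (F.coll 0) :=
  Set.range_subset_iff.2 fun n => F.block_mem_FU n.zero_le

theorem limit_tail_refines (n : ℕ) : Refines (F.limit.tail (F.block n)) (F.coll (n + 1)) := by
  rintro _ ⟨⟨m, rfl⟩, hlt⟩
  exact F.block_mem_FU (F.isBlockSeq.lt_of_blockLT hlt)

end FusionSeq

theorem exists_fusionSeq {Q : Finset ℕ+ → InfColl → Prop}
    (h : ∀ a E, Refines E D → ∃ E', Refines E' E ∧ Q a E') :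
    ∃ F : FusionSeq, F.coll 0 = D ∧ ∀ n, Q (F.block n) (F.coll (n + 1)) := by
  choose! shrink shrink_refines hQ using h
  let first (E : InfColl) : Finset ℕ+ := E.nonempty.some
  let next (E : InfColl) : InfColl := shrink (first E) (E.tail (first E))
  let coll (n : ℕ) : InfColl := next^[n] D
  have coll_succ (n) : coll (n + 1) = next (coll n) := Function.iterate_succ_apply' next n D
  have next_refines {E} (hE : Refines E D) : Refines (next E) (E.tail (first E)) :=
    shrink_refines _ _ ((E.tail_refines _).trans hE)
  have coll_refines (n) : Refines (coll n) D := by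
    induction n with
    | zero => exact Refines.refl D
    | succ n ih =>
      rw [coll_succ]
      exact ((next_refines ih).trans (InfColl.tail_refines _ _)).trans ih
  refine ⟨⟨fun n => first (coll n), coll, fun n => (coll n).nonempty.some_mem, fun n => ?_⟩,
    rfl, fun n => ?_⟩
  · rw [coll_succ]
    exact next_refines (coll_refines n)
  · change Q _ (coll (n + 1))
    rw [coll_succ]
    exact hQ _ _ (((coll n).tail_refines _).trans (coll_refines n))

theorem exists_refines_forall_mem_of_finite {ι : Type*} {T : Set ι} (hT : T.Finite)
    {P : ι → InfColl → Prop} (hmono : ∀ i E E', Refines E' E → P i E → P i E')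
    (hex : ∀ i ∈ T, ∀ E, Refines E D → ∃ E', Refines E' E ∧ P i E') (hE : Refines E D) :
    ∃ E', Refines E' E ∧ ∀ i ∈ T, P i E' := by
  induction T, hT using Set.Finite.induction_on with
  | empty => exact ⟨E, Refines.refl E, by simp⟩
  | @insert i T _ _ ih =>
    obtain ⟨E₁, hE₁, h₁⟩ := ih fun j hj => hex j (Set.mem_insert_of_mem i hj)
    obtain ⟨E₂, hE₂, h₂⟩ := hex i (Set.mem_insert i T) E₁ (hE₁.trans hE)
    exact ⟨E₂, hE₂.trans hE₁, Set.forall_mem_insert.2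
      ⟨h₂, fun j hj => hmono j E₁ E₂ hE₂ (h₁ j hj)⟩⟩

theorem finite_setOf_biUnion_subset {α : Type*} [DecidableEq α] (a : Finset α) :
    {t : Finset (Finset α) | t.biUnion id ⊆ a}.Finite :=
  a.powerset.powerset.finite_toSet.subset fun _ ht => Finset.mem_powerset.2 fun b hb =>
    Finset.mem_powerset.2 (Finset.biUnion_subset.1 ht b hb)

theorem mem_finCollIn : t ∈ finCollIn D ↔
    IsDisjointCollection (t : Set (Finset ℕ+)) ∧ (t : Set (Finset ℕ+)) ⊆ FU D.carrier :=
  Iff.rfl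

theorem empty_mem_finCollIn (D : InfColl) : ∅ ∈ finCollIn D := by
  simp [mem_finCollIn, IsDisjointCollection]

theorem Refines.finCollIn_subset (h : Refines E D) : finCollIn E ⊆ finCollIn D :=
  fun _ ht => ⟨ht.1, ht.2.trans h.FU_subset⟩

theorem exists_refines_forall_finCollIn {P : Finset (Finset ℕ+) → InfColl → Prop}
    (hmono : ∀ t E E', Refines (E'.tail (t.biUnion id)) E → P t E → P t E')
    (hex : ∀ t ∈ finCollIn D, ∀ E, Refines E D → ∃ E', Refines E' E ∧ P t E') :
    ∃ E, Refines E D ∧ ∀ t ∈ finCollIn E, P t E := by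
  obtain ⟨D₀, hD₀, h₀⟩ := hex ∅ (empty_mem_finCollIn D) D (Refines.refl D)
  have hstep (a : Finset ℕ+) (E : InfColl) (hE : Refines E D₀) : ∃ E', Refines E' E ∧
      ∀ t ∈ {t : Finset (Finset ℕ+) | t.biUnion id ⊆ a.biUnion Finset.Iic} ∩ finCollIn D, P t E' :=
    exists_refines_forall_mem_of_finite ((finite_setOf_biUnion_subset _).inter_of_left _)
      (fun t E E' h => hmono t E E' ((E'.tail_refines _).trans h))
      (fun t ht => hex t ht.2) (hE.trans hD₀)
  obtain ⟨F, rfl, hF⟩ := exists_fusionSeq hstep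
  have hlim : Refines F.limit D := F.limit_refines.trans hD₀
  refine ⟨F.limit, hlim, fun t ht => ?_⟩
  obtain rfl | hne := t.eq_empty_or_nonempty
  · exact hmono ∅ _ _ ((F.limit.tail_refines _).trans F.limit_refines) h₀
  obtain ⟨_, ⟨n, rfl⟩, hn, hsub⟩ :=
    F.limit.isDisjointCollection.exists_last_block (biUnion_mem_FU hne ht.2)
  exact hmono t _ _ ((F.limit.tail_refines_tail hn).trans (F.limit_tail_refines n))
    (hF n t ⟨hsub, hlim.finCollIn_subset ht⟩)

/-! ### Hindman's theorem for finite unions -/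

section Hindman

open Hindman

open scoped Classical in
/-- The product on finite sets to which Hindman's theorem for semigroups is applied: the union of
two successive non-empty blocks. All other products are `∅`, which is thus a zero. -/
noncomputable def blockMul (a b : Finset ℕ+) : Finset ℕ+ :=
  if a.Nonempty ∧ b.Nonempty ∧ BlockLT a b then a ∪ b else ∅

theorem blockMul_eq_union (ha : a.Nonempty) (hb : b.Nonempty) (h : BlockLT a b) :
    blockMul a b = a ∪ b :=
  if_pos ⟨ha, hb, h⟩

theorem nonempty_blockMul : (blockMul a b).Nonempty ↔ a.Nonempty ∧ b.Nonempty ∧ BlockLT a b := by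
  unfold blockMul
  split_ifs with h
  · simp [h]
  · simp [h]

theorem blockMul_assoc (a b c : Finset ℕ+) :
    blockMul (blockMul a b) c = blockMul a (blockMul b c) := by
  by_cases h : (a.Nonempty ∧ b.Nonempty ∧ BlockLT a b) ∧ c.Nonempty ∧ BlockLT b c
  · obtain ⟨⟨ha, hb, hab⟩, hc, hbc⟩ := h
    have hac : BlockLT a c := hab.trans hb hbc
    rw [blockMul_eq_union ha hb hab, blockMul_eq_union hb hc hbc,
      blockMul_eq_union (ha.mono Finset.subset_union_left) hc (blockLT_union_left.2 ⟨hac, hbc⟩),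
      blockMul_eq_union ha (hb.mono Finset.subset_union_left) (blockLT_union_right.2 ⟨hab, hac⟩),
      Finset.union_assoc]
  · have hleft : ¬ (blockMul (blockMul a b) c).Nonempty := fun hne => by
      obtain ⟨hab, hc, hlt⟩ := nonempty_blockMul.1 hne
      rw [nonempty_blockMul] at hab
      rw [blockMul_eq_union hab.1 hab.2.1 hab.2.2, blockLT_union_left] at hlt
      exact h ⟨hab, hc, hlt.2⟩
    have hright : ¬ (blockMul a (blockMul b c)).Nonempty := fun hne => by
      obtain ⟨ha, hbc, hlt⟩ := nonempty_blockMul.1 hne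
      rw [nonempty_blockMul] at hbc
      rw [blockMul_eq_union hbc.1 hbc.2.1 hbc.2.2, blockLT_union_right] at hlt
      exact h ⟨⟨ha, hbc.1, hlt.1⟩, hbc.2⟩
    rw [Finset.not_nonempty_iff_eq_empty.1 hleft, Finset.not_nonempty_iff_eq_empty.1 hright]

/-- The semigroup of finite sets under `blockMul`. -/
noncomputable abbrev blockSemigroup : Semigroup (Finset ℕ+) where
  mul := blockMul
  mul_assoc := blockMul_assoc

attribute [local instance] blockSemigroup

theorem mul_eq_blockMul (a b : Finset ℕ+) : a * b = blockMul a b := rfl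

theorem FP_subset_FU {d : Stream' (Finset ℕ+)} (hd : IsBlockSeq d.get) :
    FP d ⊆ FU (Set.range d.get) := by
  intro m hm
  induction hm with
  | head' d => exact subset_FU _ ⟨0, rfl⟩
  | tail' d m _ ih => exact FU_mono (Set.range_comp_subset_range _ d.get) (ih hd.tail)
  | cons' d m _ ih =>
    have hm : m ∈ FU (Set.range d.tail.get) := ih hd.tail
    have hne : m.Nonempty := hd.tail.toInfColl.nonempty_of_mem_FU hm
    have hlt : BlockLT d.head m := by
      obtain ⟨f, -, hf, rfl⟩ := hm
      refine blockLT_biUnion_right.2 fun b hb => ?_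
      obtain ⟨n, rfl⟩ := hf hb
      exact hd.blockLT n.succ_pos
    rw [mul_eq_blockMul, blockMul_eq_union (hd.nonempty 0) hne hlt]
    exact union_mem_FU (subset_FU _ ⟨0, rfl⟩) (FU_mono (Set.range_comp_subset_range _ d.get) hm)

theorem FP_drop_antitone {M : Type*} [Semigroup M] (d : Stream' M) :
    Antitone fun n => FP (d.drop n) := by
  intro m n h
  obtain ⟨k, rfl⟩ := Nat.exists_eq_add_of_le h
  simpa only [Stream'.drop_drop] using FP_drop_subset_FP (d.drop m) k

theorem biUnion_mem_FP_drop {d : Stream' (Finset ℕ+)} (hd : ∀ m ∈ FP d, m.Nonempty)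
    (g : Finset ℕ) (hg : g.Nonempty) (n : ℕ) (hn : ∀ i ∈ g, n ≤ i) :
    g.biUnion d.get ∈ FP (d.drop n) := by
  induction g using Finset.induction_on_min generalizing n with
  | empty => exact absurd hg Finset.not_nonempty_empty
  | insert k g hk ih =>
    refine FP_drop_antitone d (hn k (Finset.mem_insert_self k g)) ?_
    have hhead : (d.drop k).head = d.get k := Stream'.head_drop ..
    obtain rfl | hg := g.eq_empty_or_nonempty
    · simpa [hhead] using FP.head (d.drop k)
    · have hrest : g.biUnion d.get ∈ FP (d.drop k).tail := by
        rw [Stream'.tail_eq_drop, Stream'.drop_drop]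
        exact ih hg (k + 1) hk
      have hcons := FP.cons _ _ hrest
      obtain ⟨hkne, hgne, hlt⟩ := nonempty_blockMul.1 (hd _ (FP_drop_subset_FP d k hcons))
      rwa [mul_eq_blockMul, blockMul_eq_union hkne hgne hlt, hhead, ← Finset.biUnion_insert]
        at hcons

theorem FU_range_subset_FP {d : Stream' (Finset ℕ+)} (hd : ∀ m ∈ FP d, m.Nonempty) :
    FU (Set.range d.get) ⊆ FP d := by
  rintro _ ⟨f, hf, hfd, rfl⟩
  rw [← Set.image_univ, Finset.subset_set_image_iff] at hfd
  obtain ⟨g, -, rfl⟩ := hfd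
  rw [Finset.image_biUnion]
  exact biUnion_mem_FP_drop hd g (Finset.image_nonempty.1 hf) 0 fun i _ => i.zero_le

theorem isBlockSeq_of_forall_FP_nonempty {d : Stream' (Finset ℕ+)}
    (hd : ∀ m ∈ FP d, m.Nonempty) : IsBlockSeq d.get where
  nonempty n := hd _ (FP.singleton d n)
  blockLT {i j} h := (nonempty_blockMul.1 (hd _ (FP.mul_two d i j h))).2.2

theorem exists_refines_FU_subset_or_subset_compl (D : InfColl) (A : Set (Finset ℕ+)) :
    ∃ E, Refines E D ∧ (FU E.carrier ⊆ A ∨ FU E.carrier ⊆ Aᶜ) := by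
  obtain ⟨F, rfl, -⟩ := exists_fusionSeq (D := D) (Q := fun _ _ => True)
    fun _ E _ => ⟨E, Refines.refl E, trivial⟩
  set V := FU (F.coll 0).carrier
  have hFP : FP (F.block : Stream' (Finset ℕ+)) ⊆ V :=
    (FP_subset_FU F.isBlockSeq).trans F.limit_refines.FU_subset
  obtain ⟨c, hc, d, hdc⟩ := FP_partition_regular F.block {V ∩ A, V \ A}
    (Set.toFinite _) (by simpa using hFP)
  have hdV : FP d ⊆ V := by
    rcases hc with rfl | rfl
    · exact hdc.trans Set.inter_subset_left
    · exact hdc.trans Set.sdiff_subset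
  have hne : ∀ m ∈ FP d, m.Nonempty := fun m hm => InfColl.nonempty_of_mem_FU _ (hdV hm)
  have hFU : FU (Set.range d.get) ⊆ FP d := FU_range_subset_FP hne
  refine ⟨(isBlockSeq_of_forall_FP_nonempty hne).toInfColl,
    (subset_FU _).trans (hFU.trans hdV), ?_⟩
  rcases hc with rfl | rfl
  · exact Or.inl ((hFU.trans hdc).trans Set.inter_subset_right)
  · exact Or.inr ((hFU.trans hdc).trans fun _ h => h.2)

end Hindman

/-! ### Initial segments and basic sets -/

theorem IsInitialSegment.mem_tail (h : IsInitialSegment s G) (hb : b ∈ G.carrier) (hbs : b ∉ s) :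
    b ∈ (G.tail (s.biUnion id)).carrier :=
  ⟨hb, blockLT_biUnion_left.2 fun a ha => h.2 a ha b hb hbs⟩

theorem notMem_of_mem_tail (h : b ∈ (G.tail (s.biUnion id)).carrier) : b ∉ s := fun hbs =>
  not_blockLT_self (G.isDisjointCollection.1 b h.1) (blockLT_biUnion_left.1 h.2 b hbs)

theorem IsInitialSegment.union (hs : IsInitialSegment s G) (ht : IsInitialSegment t G) :
    IsInitialSegment (s ∪ t) G := by
  refine ⟨by simpa only [Finset.coe_union] using Set.union_subset hs.1 ht.1,
    fun a ha b hb hbn => ?_⟩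
  rw [Finset.notMem_union] at hbn
  exact (Finset.mem_union.1 ha).elim (fun ha => hs.2 a ha b hb hbn.1)
    fun ha => ht.2 a ha b hb hbn.2

theorem IsInitialSegment.exists_insert (h : IsInitialSegment s G) :
    ∃ x ∈ (G.tail (s.biUnion id)).carrier, IsInitialSegment (insert x s) G := by
  obtain ⟨x, hx, hfirst⟩ := (G.tail (s.biUnion id)).exists_first_block
  refine ⟨x, hx, ?_, fun a ha b hb hbn => ?_⟩
  · rw [Finset.coe_insert]
    exact Set.insert_subset hx.1 h.1
  · rw [Finset.mem_insert, not_or] at hbn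
    obtain rfl | ha := Finset.mem_insert.1 ha
    · exact hfirst b (h.mem_tail hb hbn.2) hbn.1
    · exact h.2 a ha b hb hbn.2

theorem basicSet_subset_of_tail_refines (h : Refines (E'.tail (s.biUnion id)) E) :
    basicSet s E' ⊆ basicSet s E :=
  fun _ hG => ⟨hG.1, (Refines.tail hG.2).trans h⟩

theorem basicSet_subset_of_mem (hG : G ∈ basicSet s D) (hst : s ⊆ t) (ht : IsInitialSegment t G) :
    basicSet t G ⊆ basicSet s D := by
  refine fun H hH => ⟨⟨Set.Subset.trans hst hH.1.1, fun a ha b hb hbs => ?_⟩, fun b hb => ?_⟩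
  · by_cases hbt : b ∈ t
    · exact hG.1.2 a ha b (ht.1 hbt) hbs
    · exact hH.1.2 a (hst ha) b hb hbt
  · by_cases hbt : b ∈ t
    · exact hG.2 ⟨ht.1 hbt, hb.2⟩
    · have hbG : b ∈ FU G.carrier := hH.2 (hH.1.mem_tail hb.1 hbt)
      have hGD : Refines (G.tail (s.biUnion id)) D := hG.2
      exact hGD.FU_subset ((FU_tail G _).ge ⟨hbG, hb.2⟩)

theorem basicSet_union_subset (ht : (t : Set (Finset ℕ+)) ⊆ FU (D.tail (s.biUnion id)).carrier) :
    basicSet (s ∪ t) D ⊆ basicSet s D := by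
  rw [FU_tail] at ht
  refine fun G hG => ⟨⟨Set.Subset.trans Finset.subset_union_left hG.1.1, fun a ha b hb hbs => ?_⟩,
    fun b hb => ?_⟩
  · by_cases hbt : b ∈ t
    · exact blockLT_biUnion_left.1 (ht hbt).2 a ha
    · exact hG.1.2 a (Finset.mem_union_left t ha) b hb (Finset.notMem_union.2 ⟨hbs, hbt⟩)
  · by_cases hbt : b ∈ t
    · exact (ht hbt).1
    · exact hG.2 (hG.1.mem_tail hb.1 (Finset.notMem_union.2 ⟨notMem_of_mem_tail hb, hbt⟩))

theorem sdiff_mem_finCollIn (hG : G ∈ basicSet s D) (ht : IsInitialSegment t G) :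
    t \ s ∈ finCollIn D := by
  rw [mem_finCollIn, Finset.coe_sdiff]
  exact ⟨G.isDisjointCollection.mono (Set.sdiff_subset.trans ht.1),
    fun a ha => hG.2 (hG.1.mem_tail (ht.1 ha.1) ha.2)⟩

theorem insert_mem_finCollIn (ht : t ∈ finCollIn D) (ha : a ∈ FU (D.tail (t.biUnion id)).carrier) :
    insert a t ∈ finCollIn D := by
  rw [FU_tail] at ha
  have hlt := blockLT_biUnion_left.1 ha.2
  rw [mem_finCollIn, Finset.coe_insert]
  exact ⟨⟨Set.forall_mem_insert.2 ⟨D.nonempty_of_mem_FU ha.1, ht.1.1⟩,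
    ht.1.2.insert fun b hb _ => ⟨Or.inr (hlt b hb), Or.inl (hlt b hb)⟩⟩,
    Set.insert_subset ha.1 ht.2⟩

theorem finCollIn_induction {p : Finset (Finset ℕ+) → Prop} (empty : p ∅)
    (insert : ∀ t ∈ finCollIn D, ∀ a ∈ FU (D.tail (t.biUnion id)).carrier, p t → p (insert a t)) :
    ∀ t ∈ finCollIn D, p t := by
  intro t ht
  induction t using Finset.induction_on_max_value blockMin with
  | empty => exact empty
  | insert a t hat hmax ih =>
    have hsub : (t : Set (Finset ℕ+)) ⊆ ↑(Insert.insert a t) :=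
      Finset.coe_subset.2 (Finset.subset_insert a t)
    have hts : t ∈ finCollIn D := ⟨ht.1.mono hsub, hsub.trans ht.2⟩
    have ha : a ∈ Insert.insert a t := Finset.mem_insert_self a t
    have hlt : BlockLT (t.biUnion id) a := blockLT_biUnion_left.2 fun b hb =>
      ht.1.blockLT_of_blockMin_le (hsub hb) ha (ne_of_mem_of_not_mem hb hat) (hmax b hb)
    exact insert t hts a ((FU_tail D _).ge ⟨ht.2 ha, hlt⟩) (ih hts)

/-! ### Open families are Ramsey -/

attribute [local instance] ellentuckTopology

theorem exists_basicSet_subset_of_isOpen (hO : IsOpen O) (hG : G ∈ O) :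
    ∃ t₀, IsInitialSegment t₀ G ∧ ∀ t, t₀ ⊆ t → IsInitialSegment t G → basicSet t G ⊆ O := by
  induction hO with
  | basic V hV =>
    obtain ⟨s, -, D, rfl⟩ := hV
    exact ⟨s, hG.1, fun t => basicSet_subset_of_mem hG⟩
  | univ => exact ⟨∅, by simp [IsInitialSegment], fun _ _ _ => Set.subset_univ _⟩
  | inter V W _ _ ihV ihW =>
    obtain ⟨t₁, h₁, hV⟩ := ihV hG.1
    obtain ⟨t₂, h₂, hW⟩ := ihW hG.2
    exact ⟨t₁ ∪ t₂, h₁.union h₂, fun t ht hti => Set.subset_inter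
      (hV t (Finset.union_subset_left ht) hti) (hW t (Finset.union_subset_right ht) hti)⟩
  | sUnion S _ ih =>
    obtain ⟨V, hVS, hGV⟩ := hG
    obtain ⟨t₀, h₀, hV⟩ := ih V hVS hGV
    exact ⟨t₀, h₀, fun t ht hti => (hV t ht hti).trans (Set.subset_sUnion_of_mem hVS)⟩

/-- `E` rejects `s` with respect to `O`: no refinement `E₁` of `E` satisfies `[s, E₁] ⊆ O`. -/
def Rejects (O : Set InfColl) (s : Finset (Finset ℕ+)) (E : InfColl) : Prop :=
  ∀ E₁, Refines E₁ E → ¬ basicSet s E₁ ⊆ O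

/-- `E` decides `s` with respect to `O`: it accepts `s`, that is, `[s, E] ⊆ O`, or rejects it. -/
def Decides (O : Set InfColl) (s : Finset (Finset ℕ+)) (E : InfColl) : Prop :=
  basicSet s E ⊆ O ∨ Rejects O s E

theorem Rejects.of_tail_refines (hE : Rejects O s E) (h : Refines (E'.tail (s.biUnion id)) E) :
    Rejects O s E' := by
  intro E'' hE'' hacc
  have hrefines : Refines (E''.tail (s.biUnion id)) E :=
    (Refines.tail ((E''.tail_refines _).trans hE'')).trans h
  exact hE _ hrefines ((basicSet_subset_of_tail_refines
    ((InfColl.tail_refines _ _).trans (E''.tail_refines _))).trans hacc)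

theorem Decides.of_tail_refines (hE : Decides O s E) (h : Refines (E'.tail (s.biUnion id)) E) :
    Decides O s E' :=
  hE.imp (basicSet_subset_of_tail_refines h).trans fun hrej => hrej.of_tail_refines h

theorem exists_refines_decides (O : Set InfColl) (s : Finset (Finset ℕ+)) (E : InfColl) :
    ∃ E', Refines E' E ∧ Decides O s E' := by
  by_cases h : Rejects O s E
  · exact ⟨E, Refines.refl E, Or.inr h⟩
  · simp only [Rejects, not_forall, not_not] at h
    obtain ⟨E', hE', hacc⟩ := h
    exact ⟨E', hE', Or.inl hacc⟩

theorem exists_refines_forall_decides (O : Set InfColl) (s : Finset (Finset ℕ+)) (D : InfColl) :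
    ∃ E, Refines E D ∧ ∀ t ∈ finCollIn E, Decides O (s ∪ t) E :=
  exists_refines_forall_finCollIn
    (fun _ _ E' h hdec =>
      hdec.of_tail_refines ((E'.tail_biUnion_refines Finset.subset_union_right).trans h))
    fun t _ E _ => exists_refines_decides O (s ∪ t) E

theorem Rejects.exists_refines_rejects_insert (hrej : Rejects O s E)
    (hdec : ∀ x ∈ FU (E.tail (s.biUnion id)).carrier, Decides O (insert x s) E)
    (hE' : Refines E' E) :
    ∃ E'', Refines E'' E' ∧ ∀ x ∈ FU E''.carrier, Rejects O (insert x s) E := by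
  obtain ⟨E'', hE'', hsub | hsub⟩ :=
    exists_refines_FU_subset_or_subset_compl E' {x | Rejects O (insert x s) E}
  · exact ⟨E'', hE'', hsub⟩
  have hE''E : Refines E'' E := hE''.trans hE'
  suffices hacc : basicSet s E'' ⊆ O from absurd hacc (hrej E'' hE''E)
  intro G hG
  obtain ⟨x, hx, hinit⟩ := hG.1.exists_insert
  have hGE : Refines (G.tail (s.biUnion id)) E := Refines.trans hG.2 hE''E
  have hacc : basicSet (insert x s) E ⊆ O :=
    (hdec x (hGE.tail hx)).resolve_right (hsub (hG.2 hx))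
  exact hacc ⟨hinit, (G.tail_biUnion_refines (Finset.subset_insert x s)).trans hGE⟩

theorem Rejects.exists_refines_forall_rejects (hrej : Rejects O s E)
    (hdec : ∀ t ∈ finCollIn E, Decides O (s ∪ t) E) :
    ∃ E', Refines E' E ∧ ∀ t ∈ finCollIn E', Rejects O (s ∪ t) E := by
  obtain ⟨E', hE', hstep⟩ := exists_refines_forall_finCollIn (D := E)
    (P := fun t E' => Rejects O (s ∪ t) E →
      ∀ x ∈ FU (E'.tail (t.biUnion id)).carrier, Rejects O (s ∪ insert x t) E)
    (fun t E₁ E₂ h hP ht x hx => hP ht x (h.tail.FU_subset hx))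
    (fun t ht E₁ hE₁ => by
      by_cases hst : Rejects O (s ∪ t) E
      · have hdec' (x) (hx : x ∈ FU (E.tail ((s ∪ t).biUnion id)).carrier) :
            Decides O (insert x (s ∪ t)) E := by
          rw [← Finset.union_insert]
          exact hdec _ (insert_mem_finCollIn ht
            ((E.tail_biUnion_refines Finset.subset_union_right).FU_subset hx))
        obtain ⟨E₂, hE₂, hins⟩ := hst.exists_refines_rejects_insert hdec' hE₁
        refine ⟨E₂, hE₂, fun _ x hx => ?_⟩
        rw [Finset.union_insert]
        exact hins x ((E₂.tail_refines _).FU_subset hx)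
      · exact ⟨E₁, Refines.refl E₁, fun h => absurd h hst⟩)
  refine ⟨E', hE', finCollIn_induction (by rwa [Finset.union_empty]) fun t ht x hx ih => ?_⟩
  exact hstep t ht ih x hx

theorem basicSet_subset_compl_of_forall_rejects (hO : IsOpen O)
    (h : ∀ t ∈ finCollIn E, Rejects O (s ∪ t) E) : basicSet s E ⊆ Oᶜ := by
  intro G hG hGO
  obtain ⟨t, ht, hsub⟩ := exists_basicSet_subset_of_isOpen hO hGO
  have hrej : Rejects O (s ∪ t) E := by
    simpa only [Finset.union_sdiff_self_eq_union] using h _ (sdiff_mem_finCollIn hG ht)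
  refine hrej.of_tail_refines (E' := G) ?_ G (Refines.refl G)
    (hsub _ Finset.subset_union_right (hG.1.union ht))
  exact (G.tail_biUnion_refines Finset.subset_union_left).trans hG.2

theorem exists_refines_basicSet_subset_or_subset_compl (hO : IsOpen O) (s : Finset (Finset ℕ+))
    (D : InfColl) : ∃ E, Refines E D ∧ (basicSet s E ⊆ O ∨ basicSet s E ⊆ Oᶜ) := by
  obtain ⟨E, hE, hdec⟩ := exists_refines_forall_decides O s D
  have hs : Decides O s E := by simpa only [Finset.union_empty] using hdec ∅ (empty_mem_finCollIn E)
  obtain hacc | hrej := hs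
  · exact ⟨E, hE, Or.inl hacc⟩
  obtain ⟨E', hE', hall⟩ := hrej.exists_refines_forall_rejects hdec
  exact ⟨E', hE'.trans hE, Or.inr (basicSet_subset_compl_of_forall_rejects hO fun t ht =>
    (hall t ht).of_tail_refines ((E'.tail_refines _).trans hE'))⟩

theorem isClosed_ellentuckClosure (U : Set InfColl) : IsClosed (ellentuckClosure U) :=
  isClosed_closure

theorem subset_ellentuckClosure (U : Set InfColl) : U ⊆ ellentuckClosure U :=
  subset_closure

end BlockSchreier

open BlockSchreier in
theorem theorem4p2_general (U : Set InfColl) (s : Finset (Finset ℕ+)) (D : InfColl) :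
    ∃ D₁, Refines D₁ D ∧ (basicSet s D₁ ⊆ ellentuckClosure U ∨
      ∀ t ∈ finCollIn D₁, basicSet (s ∪ t) D₁ ⊆ Uᶜ) := by
  obtain ⟨D₁, hD₁, h⟩ := exists_refines_basicSet_subset_or_subset_compl
    (isClosed_ellentuckClosure U).isOpen_compl s (D.tail (s.biUnion id))
  refine ⟨D₁, hD₁.trans (D.tail_refines _), h.symm.imp (compl_compl (ellentuckClosure U) ▸ ·) ?_⟩
  intro hcompl t ht
  have hst : (t : Set (Finset ℕ+)) ⊆ FU (D₁.tail (s.biUnion id)).carrier := fun a ha =>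
    (FU_tail D₁ _).ge ⟨ht.2 ha, hD₁.blockLT_of_mem_FU (ht.2 ha)⟩
  exact (basicSet_union_subset hst).trans
    (hcompl.trans (Set.compl_subset_compl.2 (subset_ellentuckClosure U)))

theorem theorem4p2
    (lam : Ordinal.{0} → ℕ+ → Ordinal.{0}) (hlam : BlockSchreier.IsFundamentalChoice lam)
    (U : Set BlockSchreier.InfColl)
    (s : Finset (Finset ℕ+)) (hs : s ∈ BlockSchreier.FinColl)
    (D : BlockSchreier.InfColl) :
    (∃ D₁ : BlockSchreier.InfColl, BlockSchreier.Refines D₁ D ∧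
      BlockSchreier.basicSet s D₁ ⊆ BlockSchreier.ellentuckClosure U) ∨
    (∃ ξ₀ : Ordinal.{0}, ξ₀ < ω₁ ∧
      ∀ ξ : Ordinal.{0}, ξ₀ < ξ → ξ < ω₁ →
        ∃ D₁ : BlockSchreier.InfColl, BlockSchreier.Refines D₁ D ∧
          ∀ t ∈ BlockSchreier.blockFamily lam ξ ∩ BlockSchreier.finCollIn D₁,
            BlockSchreier.basicSet (s ∪ t) D₁ ⊆ Uᶜ) := by
  obtain ⟨D₁, hD₁, h | h⟩ := theorem4p2_general U s D
  · exact Or.inl ⟨D₁, hD₁, h⟩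
  · exact Or.inr ⟨0, Ordinal.omega_pos 1, fun _ _ _ => ⟨D₁, hD₁, fun t ht => h t ht.2⟩⟩
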